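/- Let $n\ge 1$ and let $(\mathcal C,\mathbb E,\mathfrak s)$ be an $n$-exangulated category in the sense of Herschend–Liu–Nakaoka, with additive bifunctor $\mathbb E:\mathcal C^{\mathrm{op}}\times\mathcal C\to\mathrm{Ab}$. An object $P$ is projective if for every distinguished $n$-exangle $X^0\to X^1\to\cdots\to X^n\xrightarrow{d^n}X^{n+1}\dashrightarrow$ every morphism $P\to X^{n+1}$ factors through $d^n$; $\mathcal C$ has enough projectives if every object $C$ is the last term of a distinguished $n$-exangle $A\to P^1\to\cdots\to P^n\to C\dashrightarrow$ with $P^1,\dots,P^n$ projective. Injective objects and enough injectives are defined dually. Let $\underline{\mathcal C}=\mathcal C/[\mathcal P]$ (resp. $\overline{\mathcal C}=\mathcal C/[\mathcal I]$) be the quotient of $\mathcal C$ by the ideal of morphisms that factor through a projective (resp. injective) object. Suppose that $\mathcal C$ has enough projectives and enough injectives. Then for all objects $X,Y$ of $\mathcal C$: (1) $\underline{f}\mapsto\mathbb E(f,-)$ is a well-defined isomorphism of abelian groups from $\underline{\mathcal C}(X,Y)$ to the group of natural transformations $\mathbb E(Y,-)\to\mathbb E(X,-)$. (2) $\overline{f}\mapsto\mathbb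 E(-,f)$ is a well-defined isomorphism of abelian groups from $\overline{\mathcal C}(X,Y)$ to the group of natural transformations $\mathbb E(-,X)\to\mathbb E(-,Y)$. -/

import Mathlib

open CategoryTheory CategoryTheory.Limits ZeroObject Opposite

universe w v u

noncomputable section

namespace NExangulated

variable {C : Type u} [Category.{v} C] [Preadditive C]

/-! ### Extensions -/

/-- The group `𝔼(B, A)` of extensions of `B` by `A`, for a bifunctor `𝔼 : Cᵒᵖ × C → Ab`. -/
abbrev Extn (E : Cᵒᵖ ⥤ C ⥤ AddCommGrpCat.{w}) (B A : C) : Type w :=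
  (E.obj (op B)).obj A

/-- `a_* δ = 𝔼(B, a)(δ)`. -/
def push (E : Cᵒᵖ ⥤ C ⥤ AddCommGrpCat.{w}) {B A A' : C} (a : A ⟶ A') (δ : Extn E B A) :
    Extn E B A' :=
  (E.obj (op B)).map a δ

/-- `c^* δ = 𝔼(c, A)(δ)`. -/
def pull (E : Cᵒᵖ ⥤ C ⥤ AddCommGrpCat.{w}) {B B' A : C} (c : B' ⟶ B) (δ : Extn E B A) :
    Extn E B' A :=
  (E.map c.op).app A δ

/-! ### Complexes of length `n + 2` with prescribed ends -/

/-- A complex `X⁰ ⟶ X¹ ⟶ ⋯ ⟶ Xⁿ⁺¹` (vanishing outside of the degrees `0, …, n+1`) together with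
identifications `X⁰ ≅ A` and `Xⁿ⁺¹ ≅ B` of its end terms. -/
structure EndedComplex (n : ℕ) (A B : C) where
  /-- the underlying complex -/
  K : CochainComplex C ℕ
  /-- it vanishes in degrees above `n + 1` -/
  isZero : ∀ i, n + 1 < i → IsZero (K.X i)
  /-- the identification of the degree `0` term -/
  e₀ : K.X 0 ≅ A
  /-- the identification of the degree `n + 1` term -/
  e₁ : K.X (n + 1) ≅ B

namespace EndedComplex

variable {n : ℕ} {A B A' B' : C}

/-- The first differential `d⁰ : A ⟶ X¹`. -/
def dFirst (X : EndedComplex n A B) : A ⟶ X.K.X 1 := X.e₀.inv ≫ X.K.d 0 1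

/-- The last differential `dⁿ : Xⁿ ⟶ B`. -/
def dLast (X : EndedComplex n A B) : X.K.X n ⟶ B := X.K.d n (n + 1) ≫ X.e₁.hom

/-- The morphism of complexes `f` is of the form `(a, f¹, …, fⁿ, c)`. -/
def IsLift {X : EndedComplex n A B} {Y : EndedComplex n A' B'} (f : X.K ⟶ Y.K)
    (a : A ⟶ A') (c : B ⟶ B') : Prop :=
  f.f 0 ≫ Y.e₀.hom = X.e₀.hom ≫ a ∧ f.f (n + 1) ≫ Y.e₁.hom = X.e₁.hom ≫ c

/-- Homotopy equivalence of complexes with the same end terms `A` and `B`: both the morphism and its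
homotopy inverse are the identity on `A` and on `B`. -/
def HtpyEquiv (X Y : EndedComplex n A B) : Prop :=
  ∃ (f : X.K ⟶ Y.K) (g : Y.K ⟶ X.K), IsLift f (𝟙 A) (𝟙 B) ∧ IsLift g (𝟙 A) (𝟙 B) ∧
    Nonempty (Homotopy (f ≫ g) (𝟙 X.K)) ∧ Nonempty (Homotopy (g ≫ f) (𝟙 Y.K))

lemma htpyEquiv_equivalence :
    Equivalence (HtpyEquiv : EndedComplex n A B → EndedComplex n A B → Prop) where
  refl X := ⟨𝟙 _, 𝟙 _, by simp [IsLift], by simp [IsLift],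
    ⟨Homotopy.ofEq (by simp)⟩, ⟨Homotopy.ofEq (by simp)⟩⟩
  symm := by
    rintro X Y ⟨f, g, hf, hg, h₁, h₂⟩
    exact ⟨g, f, hg, hf, h₂, h₁⟩
  trans := by
    rintro X Y Z ⟨f, g, hf, hg, ⟨h₁⟩, ⟨h₂⟩⟩ ⟨f', g', hf', hg', ⟨h₁'⟩, ⟨h₂'⟩⟩
    refine ⟨f ≫ f', g' ≫ g, ?_, ?_, ⟨?_⟩, ⟨?_⟩⟩
    · simp_all [IsLift]
    · simp_all [IsLift]
    · exact (Homotopy.ofEq (by simp)).trans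
        ((((h₁'.compLeft f).compRight g).trans (Homotopy.ofEq (by simp))).trans h₁)
    · exact (Homotopy.ofEq (by simp)).trans
        ((((h₂.compLeft g').compRight f').trans (Homotopy.ofEq (by simp))).trans h₂')

/-- Homotopy equivalence relative to the end terms, as a setoid. -/
instance setoid (n : ℕ) (A B : C) : Setoid (EndedComplex n A B) := ⟨HtpyEquiv, htpyEquiv_equivalence⟩

/-- `⟨X, δ⟩` is an `n`-exangle: the sequences
`C(-, X⁰) ⟶ ⋯ ⟶ C(-, Xⁿ⁺¹) ⟶ 𝔼(-, X⁰)` and `C(Xⁿ⁺¹, -) ⟶ ⋯ ⟶ C(X⁰, -) ⟶ 𝔼(Xⁿ⁺¹, -)`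
are exact. -/
structure IsExangle (E : Cᵒᵖ ⥤ C ⥤ AddCommGrpCat.{w}) (X : EndedComplex n A B)
    (δ : Extn E B A) : Prop where
  exact_to : ∀ (Z : C) (i : ℕ), i < n →
    Function.Exact (fun g : Z ⟶ X.K.X i => g ≫ X.K.d i (i + 1))
      (fun g : Z ⟶ X.K.X (i + 1) => g ≫ X.K.d (i + 1) (i + 2))
  exact_to_last : ∀ Z : C,
    Function.Exact (fun g : Z ⟶ X.K.X n => g ≫ X.dLast) (fun g : Z ⟶ B => pull E g δ)
  exact_from : ∀ (Z : C) (i : ℕ), i < n →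
    Function.Exact (fun g : X.K.X (i + 2) ⟶ Z => X.K.d (i + 1) (i + 2) ≫ g)
      (fun g : X.K.X (i + 1) ⟶ Z => X.K.d i (i + 1) ≫ g)
  exact_from_first : ∀ Z : C,
    Function.Exact (fun g : X.K.X 1 ⟶ Z => X.dFirst ≫ g) (fun g : A ⟶ Z => push E g δ)

variable [HasZeroObject C] [HasBinaryBiproducts C]

/-- The complex `A ⟶ A ⟶ 0 ⟶ ⋯ ⟶ 0`, with first differential the identity. -/
def trivialLeft (n : ℕ) [NeZero n] (A : C) : EndedComplex n A (0 : C) where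
  K := HomologicalComplex.double (𝟙 A) (show (ComplexShape.up ℕ).Rel 0 1 by simp)
  isZero i hi := HomologicalComplex.isZero_double_X _ _ _ (by omega) (by omega)
  e₀ := HomologicalComplex.doubleXIso₀ _ _
  e₁ := (HomologicalComplex.isZero_double_X _ _ _ (by omega)
    (by have := NeZero.ne n; omega)).iso (isZero_zero C)

/-- The complex `0 ⟶ ⋯ ⟶ 0 ⟶ A ⟶ A`, with last differential the identity. -/
def trivialRight (n : ℕ) [NeZero n] (A : C) : EndedComplex n (0 : C) A where
  K := HomologicalComplex.double (𝟙 A) (show (ComplexShape.up ℕ).Rel n (n + 1) by simp)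
  isZero i hi := HomologicalComplex.isZero_double_X _ _ _ (by omega) (by omega)
  e₀ := (HomologicalComplex.isZero_double_X _ _ _ (by have := NeZero.ne n; omega)
    (by omega)).iso (isZero_zero C)
  e₁ := HomologicalComplex.doubleXIso₁ _ _ (by omega)

/-- `M` is, up to an isomorphism that is the identity on the end terms, the mapping cone
`X¹ ⟶ X² ⊕ Y¹ ⟶ ⋯ ⟶ Xⁿ⁺¹ ⊕ Yⁿ ⟶ Yⁿ⁺¹` of a morphism `f : X ⟶ Y` with `f⁰ = 1`, whose differentials
are `(-d, f)`, then `(x, y) ↦ (-d x, f x + d y)`, and finally `(x, y) ↦ f x + d y`. -/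
def IsMappingCone {X : EndedComplex n A B} {Y : EndedComplex n A B'} (f : X.K ⟶ Y.K)
    (M : EndedComplex n (X.K.X 1) B') : Prop :=
  ∃ φ : ∀ i, 1 ≤ i → i ≤ n → (M.K.X i ≅ X.K.X (i + 1) ⊞ Y.K.X i),
    (∀ h : 1 ≤ n, M.dFirst ≫ (φ 1 le_rfl h).hom = biprod.lift (-X.K.d 1 2) (f.f 1)) ∧
    (∀ (i : ℕ) (h : 1 ≤ i) (h' : i + 1 ≤ n),
      M.K.d i (i + 1) ≫ (φ (i + 1) (by omega) h').hom =
        (φ i h (by omega)).hom ≫ biprod.lift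
          (biprod.fst ≫ (-X.K.d (i + 1) (i + 2)))
          (biprod.fst ≫ f.f (i + 1) + biprod.snd ≫ Y.K.d i (i + 1))) ∧
    (∀ h : 1 ≤ n, M.dLast =
      (φ n h le_rfl).hom ≫ biprod.desc (f.f (n + 1) ≫ Y.e₁.hom) Y.dLast)

/-- `N` is, up to an isomorphism that is the identity on the end terms, the mapping cocone
`X⁰ ⟶ Y⁰ ⊕ X¹ ⟶ ⋯ ⟶ Yⁿ⁻¹ ⊕ Xⁿ ⟶ Yⁿ` of a morphism `f : X ⟶ Y` with `fⁿ⁺¹ = 1`, whose differentials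
are `(f, d)`, then `(y, x) ↦ (-d y + f x, d x)`, and finally `(y, x) ↦ -d y + f x`. -/
def IsMappingCocone {X : EndedComplex n A B} {Y : EndedComplex n A' B} (f : X.K ⟶ Y.K)
    (N : EndedComplex n A (Y.K.X n)) : Prop :=
  ∃ φ : ∀ i, 1 ≤ i → i ≤ n → (N.K.X i ≅ Y.K.X (i - 1) ⊞ X.K.X i),
    (∀ h : 1 ≤ n,
      N.dFirst ≫ (φ 1 le_rfl h).hom = biprod.lift (X.e₀.inv ≫ f.f 0) X.dFirst) ∧
    (∀ (i : ℕ) (h : 1 ≤ i) (h' : i + 1 ≤ n),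
      N.K.d i (i + 1) ≫ (φ (i + 1) (by omega) h').hom =
        (φ i h (by omega)).hom ≫ biprod.lift
          (biprod.fst ≫ (-Y.K.d (i - 1) i) + biprod.snd ≫ f.f i)
          (biprod.snd ≫ X.K.d i (i + 1))) ∧
    (∀ h : 1 ≤ n, N.dLast = (φ n h le_rfl).hom ≫ biprod.desc (-Y.K.d (n - 1) n) (f.f n))

end EndedComplex

open EndedComplex

/-! ### `n`-exangulated categories -/

/-- A correspondence `𝔰` associating to every extension `δ ∈ 𝔼(B, A)` a homotopy equivalence class
of complexes with end terms `A` and `B`. -/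
abbrev Correspondence (n : ℕ) (E : Cᵒᵖ ⥤ C ⥤ AddCommGrpCat.{w}) :=
  ∀ ⦃A B : C⦄, Extn E B A → _root_.Quotient (EndedComplex.setoid n A B)

section

variable {n : ℕ} {E : Cᵒᵖ ⥤ C ⥤ AddCommGrpCat.{w}} (s : Correspondence n E)

/-- `X` realizes `δ`, i.e. `𝔰(δ) = [X]`. -/
def Realizes {A B : C} (X : EndedComplex n A B) (δ : Extn E B A) : Prop :=
  s δ = _root_.Quotient.mk (EndedComplex.setoid n A B) X

/-- `f` is an inflation: it is the differential `d⁰` of a complex realizing some extension. -/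
def IsInflation {A D : C} (f : A ⟶ D) : Prop :=
  ∃ (B : C) (δ : Extn E B A) (X : EndedComplex n A B) (e : X.K.X 1 ≅ D),
    Realizes s X δ ∧ X.dFirst ≫ e.hom = f

/-- `g` is a deflation: it is the differential `dⁿ` of a complex realizing some extension. -/
def IsDeflation {D B : C} (g : D ⟶ B) : Prop :=
  ∃ (A : C) (δ : Extn E B A) (X : EndedComplex n A B) (e : D ≅ X.K.X n),
    Realizes s X δ ∧ e.hom ≫ X.dLast = g

end

variable [HasZeroObject C] [HasBinaryBiproducts C]

/-- An `n`-exangulated structure on the additive category `C` with additive bifunctor `𝔼`: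
an exact realization `𝔰` of `𝔼` that satisfies (EA1), (EA2) and (EA2ᵒᵖ). -/
structure NExangulatedStructure (n : ℕ) [NeZero n] (E : Cᵒᵖ ⥤ C ⥤ AddCommGrpCat.{w}) where
  /-- the realization -/
  s : Correspondence n E
  /-- (R0) -/
  exists_lift : ∀ {A B A' B' : C} (δ : Extn E B A) (ρ : Extn E B' A') (X : EndedComplex n A B)
    (Y : EndedComplex n A' B'), Realizes s X δ → Realizes s Y ρ →
    ∀ (a : A ⟶ A') (c : B ⟶ B'), push E a δ = pull E c ρ →
      ∃ f : X.K ⟶ Y.K, IsLift f a c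
  /-- (R1) -/
  isExangle : ∀ {A B : C} (δ : Extn E B A) (X : EndedComplex n A B),
    Realizes s X δ → IsExangle E X δ
  /-- (R2) -/
  realizes_trivialLeft : ∀ A : C, Realizes s (trivialLeft n A) (0 : Extn E (0 : C) A)
  /-- (R2), dual -/
  realizes_trivialRight : ∀ A : C, Realizes s (trivialRight n A) (0 : Extn E A (0 : C))
  /-- (EA1) -/
  inflation_comp : ∀ {A B D : C} (f : A ⟶ B) (g : B ⟶ D),
    IsInflation s f → IsInflation s g → IsInflation s (f ≫ g)
  /-- (EA1), dual -/
  deflation_comp : ∀ {A B D : C} (f : A ⟶ B) (g : B ⟶ D),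
    IsDeflation s f → IsDeflation s g → IsDeflation s (f ≫ g)
  /-- (EA2) -/
  exists_good_lift : ∀ {A B D : C} (ρ : Extn E D A) (c : B ⟶ D) (X : EndedComplex n A B)
    (Y : EndedComplex n A D), Realizes s X (pull E c ρ) → Realizes s Y ρ →
    ∃ (f : X.K ⟶ Y.K) (M : EndedComplex n (X.K.X 1) D),
      IsLift f (𝟙 A) c ∧ IsMappingCone f M ∧ Realizes s M (push E X.dFirst ρ)
  /-- (EA2ᵒᵖ) -/
  exists_good_lift_op : ∀ {A A' B : C} (ρ : Extn E B A) (a : A ⟶ A') (X : EndedComplex n A B)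
    (Y : EndedComplex n A' B), Realizes s X ρ → Realizes s Y (push E a ρ) →
    ∃ (f : X.K ⟶ Y.K) (N : EndedComplex n A (Y.K.X n)),
      IsLift f a (𝟙 B) ∧ IsMappingCocone f N ∧ Realizes s N (pull E Y.dLast ρ)

/-! ### Projective and injective objects -/

section

variable {n : ℕ} {E : Cᵒᵖ ⥤ C ⥤ AddCommGrpCat.{w}} (s : Correspondence n E)

/-- The projective objects: morphisms out of them lift along `dⁿ`, for all distinguished
`n`-exangles. -/
def projectives : ObjectProperty C := fun P =>
  ∀ ⦃A B : C⦄ (δ : Extn E B A) (X : EndedComplex n A B), Realizes s X δ →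
    ∀ c : P ⟶ B, ∃ b : P ⟶ X.K.X n, b ≫ X.dLast = c

/-- The injective objects: morphisms into them extend along `d⁰`, for all distinguished
`n`-exangles. -/
def injectives : ObjectProperty C := fun I =>
  ∀ ⦃A B : C⦄ (δ : Extn E B A) (X : EndedComplex n A B), Realizes s X δ →
    ∀ a : A ⟶ I, ∃ b : X.K.X 1 ⟶ I, X.dFirst ≫ b = a

/-- Every object `B` has a distinguished `n`-exangle `A ⟶ P¹ ⟶ ⋯ ⟶ Pⁿ ⟶ B` with all `Pⁱ`
projective. -/
def HasEnoughProjectives : Prop :=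
  ∀ B : C, ∃ (A : C) (δ : Extn E B A) (X : EndedComplex n A B), Realizes s X δ ∧
    ∀ i, 1 ≤ i → i ≤ n → projectives s (X.K.X i)

/-- Every object `A` has a distinguished `n`-exangle `A ⟶ I¹ ⟶ ⋯ ⟶ Iⁿ ⟶ B` with all `Iⁱ`
injective. -/
def HasEnoughInjectives : Prop :=
  ∀ A : C, ∃ (B : C) (δ : Extn E B A) (X : EndedComplex n A B), Realizes s X δ ∧
    ∀ i, 1 ≤ i → i ≤ n → injectives s (X.K.X i)

end

/-! ### Ideal quotients and stable categories -/

/-- Two parallel morphisms are congruent modulo the ideal `[𝒳]` if their difference factors through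
an object of the full subcategory `𝒳`. -/
def idealRel (𝒳 : ObjectProperty C) : HomRel C := fun X Y f g =>
  ∃ (Z : C) (_ : 𝒳 Z) (p : X ⟶ Z) (q : Z ⟶ Y), f - g = p ≫ q

/-- The full subcategory contains zero objects and is closed under direct sums. -/
class IsAdditiveSub (𝒳 : ObjectProperty C) : Prop where
  zero : 𝒳 0
  biprod : ∀ X Y, 𝒳 X → 𝒳 Y → 𝒳 (X ⊞ Y)

variable (𝒳 : ObjectProperty C) [IsAdditiveSub 𝒳]

lemma idealRel_add ⦃X Y : C⦄ (f₁ f₂ g₁ g₂ : X ⟶ Y) (hf : idealRel 𝒳 f₁ f₂)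
    (hg : idealRel 𝒳 g₁ g₂) : idealRel 𝒳 (f₁ + g₁) (f₂ + g₂) := by
  obtain ⟨Z, hZ, p, q, h⟩ := hf
  obtain ⟨W, hW, p', q', h'⟩ := hg
  refine ⟨Z ⊞ W, IsAdditiveSub.biprod _ _ hZ hW, biprod.lift p p', biprod.desc q q', ?_⟩
  rw [biprod.lift_desc, ← h, ← h']
  abel

instance : Congruence (idealRel 𝒳) where
  equivalence :=
    { refl f := ⟨0, IsAdditiveSub.zero, 0, 0, by simp⟩
      symm := by
        rintro f g ⟨Z, hZ, p, q, h⟩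
        exact ⟨Z, hZ, -p, q, by rw [Preadditive.neg_comp, ← h, neg_sub]⟩
      trans := by
        intro f g k h₁ h₂
        have := idealRel_add 𝒳 _ _ _ _ h₁ h₂
        obtain ⟨Z, hZ, p, q, h⟩ := this
        exact ⟨Z, hZ, p, q, by rw [← h]; abel⟩ }
  comp_left := by
    rintro X Y Z k f g ⟨W, hW, p, q, h⟩
    exact ⟨W, hW, k ≫ p, q, by rw [← Preadditive.comp_sub, h, Category.assoc]⟩
  comp_right := by
    rintro X Y Z f g k ⟨W, hW, p, q, h⟩
    exact ⟨W, hW, p, q ≫ k, by rw [← Preadditive.sub_comp, h, Category.assoc]⟩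

/-- The quotient category `C/[𝒳]`. -/
abbrev IdealQuotient : Type u := CategoryTheory.Quotient (idealRel 𝒳)

instance : Preadditive (IdealQuotient 𝒳) :=
  CategoryTheory.Quotient.preadditive (idealRel 𝒳) (idealRel_add 𝒳)

/-- The quotient functor `C ⥤ C/[𝒳]`. -/
abbrev toIdealQuotient : C ⥤ IdealQuotient 𝒳 := CategoryTheory.Quotient.functor (idealRel 𝒳)

section

variable {n : ℕ} {E : Cᵒᵖ ⥤ C ⥤ AddCommGrpCat.{w}} (s : Correspondence n E)

instance : IsAdditiveSub (projectives s) where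
  zero _ _ _ _ _ _ := ⟨0, (isZero_zero C).eq_of_src _ _⟩
  biprod P Q hP hQ A B δ X hX c := by
    obtain ⟨b, hb⟩ := hP δ X hX (biprod.inl ≫ c)
    obtain ⟨b', hb'⟩ := hQ δ X hX (biprod.inr ≫ c)
    exact ⟨biprod.desc b b', by ext <;> simp [hb, hb']⟩

instance : IsAdditiveSub (injectives s) where
  zero _ _ _ _ _ _ := ⟨0, (isZero_zero C).eq_of_tgt _ _⟩
  biprod P Q hP hQ A B δ X hX c := by
    obtain ⟨b, hb⟩ := hP δ X hX (c ≫ biprod.fst)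
    obtain ⟨b', hb'⟩ := hQ δ X hX (c ≫ biprod.snd)
    exact ⟨biprod.lift b b', by ext <;> simp [hb, hb']⟩

/-- The quotient functor from `C` to the stable category `C/[𝒫]`. -/
abbrev toStable : C ⥤ IdealQuotient (projectives s) := toIdealQuotient (projectives s)

/-- The quotient functor from `C` to the costable category `C/[ℐ]`. -/
abbrev toCostable : C ⥤ IdealQuotient (injectives s) := toIdealQuotient (injectives s)

end

end NExangulated

end

/-! A Yoneda-type argument. Fix a distinguished `n`-exangle `A ⟶ P¹ ⟶ ⋯ ⟶ Pⁿ ⟶ Y` with projective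
middle terms and extension `δ`. Since `𝔼(Pⁿ, -) = 0`, exactness of `C(A, -) ⟶ 𝔼(Y, -) ⟶ 𝔼(Pⁿ, -)`
(`exists_push_eq`) makes every element of `𝔼(Y, -)` a pushforward of `δ`, so a natural
transformation `α` is determined by `α(δ)`. By naturality `α(δ)` dies in `𝔼(X, P¹)`, so exactness of
`C(-, Y) ⟶ 𝔼(-, A) ⟶ 𝔼(-, P¹)` (`exists_pull_eq`) gives `α(δ) = f^*δ`, whence `α = 𝔼(f, -)`. If
`𝔼(f, -) = 0`, then `f^*δ = 0` and `f` factors through `Pⁿ`; conversely, maps through projectives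
act by zero. The two exactness statements go one step beyond the definition of an `n`-exangle; they
come from (EA2) and its dual, applied to extensions with a biproduct as end term. The injective case
is dual. -/

namespace NExangulated

/-! ### Calculus of pushforwards and pullbacks of extensions. -/

section Bifunctor

variable {C : Type u} [Category.{v} C] {E : Cᵒᵖ ⥤ C ⥤ AddCommGrpCat.{w}}

@[simp] lemma push_id {B A : C} (δ : Extn E B A) : push E (𝟙 A) δ = δ := by simp [push]

@[simp] lemma pull_id {B A : C} (δ : Extn E B A) : pull E (𝟙 B) δ = δ := by simp [pull]

lemma push_comp {B A A' A'' : C} (a : A ⟶ A') (a' : A' ⟶ A'') (δ : Extn E B A) :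
    push E (a ≫ a') δ = push E a' (push E a δ) := by simp [push]

lemma pull_comp {B B' B'' A : C} (c : B' ⟶ B) (c' : B'' ⟶ B') (δ : Extn E B A) :
    pull E (c' ≫ c) δ = pull E c' (pull E c δ) := by simp [pull]

lemma push_pull {B B' A A' : C} (a : A ⟶ A') (c : B' ⟶ B) (δ : Extn E B A) :
    push E a (pull E c δ) = pull E c (push E a δ) :=
  (ConcreteCategory.congr_hom ((E.map c.op).naturality a) δ).symm

lemma push_add {B A A' : C} (a : A ⟶ A') (δ δ' : Extn E B A) :
    push E a (δ + δ') = push E a δ + push E a δ' := map_add _ _ _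

lemma pull_add {B B' A : C} (c : B' ⟶ B) (δ δ' : Extn E B A) :
    pull E c (δ + δ') = pull E c δ + pull E c δ' := map_add _ _ _

@[simp] lemma push_zero {B A A' : C} (a : A ⟶ A') : push E a (0 : Extn E B A) = 0 := map_zero _

@[simp] lemma pull_zero {B B' A : C} (c : B' ⟶ B) : pull E c (0 : Extn E B A) = 0 := map_zero _

variable [Preadditive C]

lemma add_push [∀ B : Cᵒᵖ, (E.obj B).Additive] {B A A' : C} (a a' : A ⟶ A') (δ : Extn E B A) :
    push E (a + a') δ = push E a δ + push E a' δ := by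
  simp [push, Functor.map_add]

lemma add_pull [E.Additive] {B B' A : C} (c c' : B' ⟶ B) (δ : Extn E B A) :
    pull E (c + c') δ = pull E c δ + pull E c' δ := by
  simp [pull, Functor.map_add]

@[simp] lemma zero_push [∀ B : Cᵒᵖ, (E.obj B).Additive] {B A A' : C} (δ : Extn E B A) :
    push E (0 : A ⟶ A') δ = 0 := by
  simp [push]

@[simp] lemma zero_pull [E.Additive] {B B' A : C} (δ : Extn E B A) :
    pull E (0 : B' ⟶ B) δ = 0 := by
  simp [pull]

end Bifunctor

/-! ### Consequences of the exactness of an `n`-exangle. -/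

section Realizations

variable {C : Type u} [Category.{v} C] [Preadditive C] {n : ℕ}
  {E : Cᵒᵖ ⥤ C ⥤ AddCommGrpCat.{w}}

lemma exists_realizes (s : Correspondence n E) {A B : C} (δ : Extn E B A) :
    ∃ X : EndedComplex n A B, Realizes s X δ :=
  (_root_.Quotient.exists_rep (s δ)).imp fun _ h => h.symm

namespace EndedComplex.IsExangle

variable {A B : C} {X : EndedComplex n A B} {δ : Extn E B A}

lemma pull_dLast (hX : IsExangle E X δ) : pull E X.dLast δ = 0 :=
  (hX.exact_to_last _ X.dLast).2 ⟨𝟙 _, Category.id_comp _⟩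

lemma push_dFirst (hX : IsExangle E X δ) : push E X.dFirst δ = 0 :=
  (hX.exact_from_first _ X.dFirst).2 ⟨𝟙 _, Category.comp_id _⟩

lemma exists_comp_dLast (hX : IsExangle E X δ) {Z : C} (c : Z ⟶ B) (hc : pull E c δ = 0) :
    ∃ b : Z ⟶ X.K.X n, b ≫ X.dLast = c :=
  (hX.exact_to_last _ c).1 hc

lemma exists_dFirst_comp (hX : IsExangle E X δ) {Z : C} (a : A ⟶ Z) (ha : push E a δ = 0) :
    ∃ b : X.K.X 1 ⟶ Z, X.dFirst ≫ b = a :=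
  (hX.exact_from_first _ a).1 ha

end EndedComplex.IsExangle

end Realizations

/-! ### Exactness at `𝔼`, and the action of morphisms on extensions. -/

section Structure

open EndedComplex

variable {C : Type u} [Category.{v} C] [Preadditive C] [HasZeroObject C] [HasBinaryBiproducts C]
  {n : ℕ} [NeZero n] {E : Cᵒᵖ ⥤ C ⥤ AddCommGrpCat.{w}} (S : NExangulatedStructure n E)

/-- Exactness of `C(-, Xⁿ⁺¹) ⟶ 𝔼(-, X⁰) ⟶ 𝔼(-, X¹)` for a distinguished `n`-exangle. -/
lemma exists_pull_eq [E.Additive] {A B D : C} {δ : Extn E B A} {X : EndedComplex n A B}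
    (hX : Realizes S.s X δ) (ρ : Extn E D A) (hρ : push E X.dFirst ρ = 0) :
    ∃ g : D ⟶ B, pull E g δ = ρ := by
  -- `θ` restricts to `δ` on `B` and to `ρ` on `D`. The cone of a good lift over `biprod.inl`
  -- realizes `d⁰_* θ = 0`, so every map into `B ⊞ D` lifts along its last differential, in
  -- particular `biprod.inr`.
  let θ : Extn E (B ⊞ D) A := pull E biprod.fst δ + pull E biprod.snd ρ
  have hinl : pull E biprod.inl θ = δ := by simp [θ, pull_add, ← pull_comp]
  have hinr : pull E biprod.inr θ = ρ := by simp [θ, pull_add, ← pull_comp]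
  have hθ : push E X.dFirst θ = 0 := by
    simp [θ, push_add, push_pull, hρ, (S.isExangle _ _ hX).push_dFirst]
  obtain ⟨Z, hZ⟩ := exists_realizes S.s θ
  obtain ⟨f, M, ⟨-, hf⟩, ⟨φ, -, -, hφ⟩, hM⟩ :=
    S.exists_good_lift θ biprod.inl X Z (hinl.symm ▸ hX) hZ
  obtain ⟨m, hm⟩ := (S.isExangle _ _ hM).exists_comp_dLast (biprod.inr : D ⟶ B ⊞ D)
    (by simp [hθ])
  have h1 : 1 ≤ n := NeZero.one_le
  let t := m ≫ (φ n h1 le_rfl).hom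
  -- The two components of the lift in `Xⁿ⁺¹ ⊞ Zⁿ`. Pulling `θ` back along this identity kills the
  -- second summand, because `Z` realizes `θ`.
  have ht : (t ≫ biprod.fst ≫ X.e₁.hom) ≫ biprod.inl + (t ≫ biprod.snd) ≫ Z.dLast =
      (biprod.inr : D ⟶ B ⊞ D) := by
    rw [← hm, hφ h1, hf, biprod.desc_eq]
    simp [t]
  refine ⟨t ≫ biprod.fst ≫ X.e₁.hom, ?_⟩
  have key := congrArg (fun c => pull E c θ) ht
  simpa only [add_pull, pull_comp, hinl, hinr, (S.isExangle _ _ hZ).pull_dLast, pull_zero,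
    add_zero] using key

/-- Exactness of `C(X⁰, -) ⟶ 𝔼(Xⁿ⁺¹, -) ⟶ 𝔼(Xⁿ, -)` for a distinguished `n`-exangle. -/
lemma exists_push_eq [∀ B : Cᵒᵖ, (E.obj B).Additive] {A B D : C} {δ : Extn E B A}
    {X : EndedComplex n A B} (hX : Realizes S.s X δ) (ρ : Extn E B D)
    (hρ : pull E X.dLast ρ = 0) :
    ∃ g : A ⟶ D, push E g δ = ρ := by
  -- Dual gluing: the cocone of a good lift over `biprod.fst` realizes `(dⁿ)^* θ = 0`, so
  -- `biprod.snd` extends along its first differential, which maps `A ⊞ D` to `X⁰ ⊞ Z¹`.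
  let θ : Extn E B (A ⊞ D) := push E biprod.inl δ + push E biprod.inr ρ
  have hfst : push E biprod.fst θ = δ := by simp [θ, push_add, ← push_comp]
  have hsnd : push E biprod.snd θ = ρ := by simp [θ, push_add, ← push_comp]
  have hθ : pull E X.dLast θ = 0 := by
    simp [θ, pull_add, ← push_pull, hρ, (S.isExangle _ _ hX).pull_dLast]
  obtain ⟨Z, hZ⟩ := exists_realizes S.s θ
  obtain ⟨f, N, ⟨hf, -⟩, ⟨φ, hφ, -, -⟩, hN⟩ :=
    S.exists_good_lift_op θ biprod.fst Z X hZ (hfst.symm ▸ hX)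
  obtain ⟨m, hm⟩ := (S.isExangle _ _ hN).exists_dFirst_comp (biprod.snd : A ⊞ D ⟶ D)
    (by simp [hθ])
  have h1 : 1 ≤ n := NeZero.one_le
  let t : X.K.X 0 ⊞ Z.K.X 1 ⟶ D := (φ 1 le_rfl h1).inv ≫ m
  have hN₁ : N.dFirst = biprod.lift (biprod.fst ≫ X.e₀.inv) Z.dFirst ≫
      (φ 1 le_rfl h1).inv := by
    rw [Iso.eq_comp_inv, hφ h1]
    congr 1
    rw [Iso.inv_comp_eq, ← Category.assoc, Iso.eq_comp_inv, hf]
  have ht : biprod.fst ≫ X.e₀.inv ≫ biprod.inl ≫ t + Z.dFirst ≫ biprod.inr ≫ t =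
      (biprod.snd : A ⊞ D ⟶ D) := by
    rw [← hm, hN₁, biprod.lift_eq]
    simp [t]
  refine ⟨X.e₀.inv ≫ biprod.inl ≫ t, ?_⟩
  have key := congrArg (fun a => push E a θ) ht
  simp only [add_push, push_comp _ _ θ, hfst, hsnd, (S.isExangle _ _ hZ).push_dFirst,
    push_zero, add_zero] at key
  exact key

/-- The identity of `P` lifts along `dⁿ`, and pulling `δ` back along `dⁿ` already gives zero. -/
lemma extn_eq_zero_of_projective {P A : C} (hP : projectives S.s P) (δ : Extn E P A) :
    δ = 0 := by
  obtain ⟨X, hX⟩ := exists_realizes S.s δ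
  obtain ⟨b, hb⟩ := hP δ X hX (𝟙 P)
  rw [← pull_id δ, ← hb, pull_comp, (S.isExangle _ _ hX).pull_dLast, pull_zero]

lemma extn_eq_zero_of_injective {I B : C} (hI : injectives S.s I) (δ : Extn E B I) :
    δ = 0 := by
  obtain ⟨X, hX⟩ := exists_realizes S.s δ
  obtain ⟨b, hb⟩ := hI δ X hX (𝟙 I)
  rw [← push_id δ, ← hb, push_comp, (S.isExangle _ _ hX).push_dFirst, push_zero]

lemma map_op_eq_zero_iff (hP : HasEnoughProjectives S.s) {X Y : C} (f : X ⟶ Y) :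
    E.map f.op = 0 ↔ idealRel (projectives S.s) f 0 := by
  constructor
  · intro hf
    obtain ⟨A, δ, K, hK, hproj⟩ := hP Y
    -- Only the vanishing of `f^*` on the single extension `δ` is used.
    obtain ⟨b, hb⟩ := (S.isExangle _ _ hK).exists_comp_dLast f (by simp [pull, hf])
    exact ⟨K.K.X n, hproj n NeZero.one_le le_rfl, b, K.dLast, by rw [hb, sub_zero]⟩
  · rintro ⟨P, hproj, p, q, h⟩
    rw [sub_zero] at h
    ext A δ
    change pull E f δ = 0
    rw [h, pull_comp, extn_eq_zero_of_projective S hproj (pull E q δ), pull_zero]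

lemma flip_map_eq_zero_iff (hI : HasEnoughInjectives S.s) {X Y : C} (f : X ⟶ Y) :
    E.flip.map f = 0 ↔ idealRel (injectives S.s) f 0 := by
  constructor
  · intro hf
    obtain ⟨B, δ, K, hK, hinj⟩ := hI X
    obtain ⟨b, hb⟩ := (S.isExangle _ _ hK).exists_dFirst_comp f
      (ConcreteCategory.congr_hom (NatTrans.congr_app hf (op B)) δ)
    exact ⟨K.K.X 1, hinj 1 le_rfl NeZero.one_le, K.dFirst, b, by rw [hb, sub_zero]⟩
  · rintro ⟨I, hinj, p, q, h⟩
    rw [sub_zero] at h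
    ext B δ
    change push E f (B := B.unop) δ = 0
    rw [h, push_comp, extn_eq_zero_of_injective S hinj (push E p (B := B.unop) δ), push_zero]

lemma exists_map_op_eq [E.Additive] [∀ B : Cᵒᵖ, (E.obj B).Additive]
    (hP : HasEnoughProjectives S.s) {X Y : C} (α : E.obj (op Y) ⟶ E.obj (op X)) :
    ∃ f : X ⟶ Y, E.map f.op = α := by
  have hα {A A' : C} (a : A ⟶ A') (δ : Extn E Y A) :
      α.app A' (push E a δ) = push E a (α.app A δ) :=
    ConcreteCategory.congr_hom (α.naturality a) δ
  obtain ⟨A, δ, K, hK, hproj⟩ := hP Y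
  -- `f` is chosen to match `α` on `δ` alone; since `δ` generates `𝔼(Y, -)` under pushforward,
  -- naturality then forces agreement everywhere.
  obtain ⟨f, hf⟩ := exists_pull_eq S hK (α.app A δ)
    (by rw [← hα, (S.isExangle _ _ hK).push_dFirst, map_zero])
  refine ⟨f, ?_⟩
  ext D θ
  obtain ⟨a, rfl⟩ := exists_push_eq S hK θ
    (extn_eq_zero_of_projective S (hproj n NeZero.one_le le_rfl) _)
  change pull E f (push E a δ) = _
  rw [← push_pull, hf, ← hα]

lemma exists_flip_map_eq [E.Additive] [∀ B : Cᵒᵖ, (E.obj B).Additive]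
    (hI : HasEnoughInjectives S.s) {X Y : C} (α : E.flip.obj X ⟶ E.flip.obj Y) :
    ∃ f : X ⟶ Y, E.flip.map f = α := by
  have hα {B B' : C} (c : B' ⟶ B) (δ : Extn E B X) :
      α.app (op B') (pull E c δ) = pull E (A := Y) c (α.app (op B) δ) :=
    ConcreteCategory.congr_hom (α.naturality c.op) δ
  obtain ⟨B, δ, K, hK, hinj⟩ := hI X
  obtain ⟨f, hf⟩ := exists_push_eq S hK (D := Y) (α.app (op B) δ)
    (by rw [← hα, (S.isExangle _ _ hK).pull_dLast]; exact map_zero _)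
  refine ⟨f, ?_⟩
  ext ⟨D⟩ θ
  obtain ⟨c, rfl⟩ := exists_pull_eq S hK (D := D) θ
    (extn_eq_zero_of_injective S (hinj 1 le_rfl NeZero.one_le) _)
  change push E f (pull E c δ) = _
  rw [push_pull, hf, ← hα]

end Structure

/-- A surjective homomorphism out of `C(X, Y)` with kernel `[𝒳](X, Y)` induces an isomorphism
out of `(C/[𝒳])(X, Y)`. -/
lemma exists_addEquiv_idealQuotient {C : Type u} [Category.{v} C] [Preadditive C]
    [HasZeroObject C] [HasBinaryBiproducts C] (𝒳 : ObjectProperty C) [IsAdditiveSub 𝒳]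
    {X Y : C} {G : Type*} [AddCommGroup G] (φ : (X ⟶ Y) →+ G) (hφ : Function.Surjective φ)
    (hker : ∀ f, φ f = 0 ↔ idealRel 𝒳 f 0) :
    ∃ Φ : ((toIdealQuotient 𝒳).obj X ⟶ (toIdealQuotient 𝒳).obj Y) ≃+ G,
      ∀ f : X ⟶ Y, Φ ((toIdealQuotient 𝒳).map f) = φ f := by
  have : (toIdealQuotient 𝒳).Additive :=
    CategoryTheory.Quotient.functor_additive (idealRel 𝒳) (idealRel_add 𝒳)
  let π : (X ⟶ Y) →+ ((toIdealQuotient 𝒳).obj X ⟶ (toIdealQuotient 𝒳).obj Y) :=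
    (toIdealQuotient 𝒳).mapAddHom
  have hπ : Function.Surjective π := (toIdealQuotient 𝒳).map_surjective
  -- Both kernels are the ideal `[𝒳](X, Y)`, so both targets are the same quotient of `C(X, Y)`.
  have hπφ : π.ker = φ.ker := by
    ext f
    rw [AddMonoidHom.mem_ker, AddMonoidHom.mem_ker, hker,
      ← CategoryTheory.Quotient.functor_map_eq_iff (idealRel 𝒳), Functor.map_zero]
    rfl
  refine ⟨(QuotientAddGroup.quotientKerEquivOfSurjective π hπ).symm.trans
    ((QuotientAddGroup.quotientAddEquivOfEq hπφ).trans
      (QuotientAddGroup.quotientKerEquivOfSurjective φ hφ)), fun f => ?_⟩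
  have : (QuotientAddGroup.quotientKerEquivOfSurjective π hπ).symm
      ((toIdealQuotient 𝒳).map f) = (f : (X ⟶ Y) ⧸ π.ker) := by
    rw [AddEquiv.symm_apply_eq]
    rfl
  simp only [AddEquiv.trans_apply, this]
  rfl

end NExangulated

theorem theorem3p8 {C : Type u} [Category.{v} C] [Preadditive C] [HasZeroObject C]
    [HasBinaryBiproducts C] (n : ℕ) [NeZero n]
    (E : Cᵒᵖ ⥤ C ⥤ AddCommGrpCat.{w}) [E.Additive] [∀ B : Cᵒᵖ, (E.obj B).Additive]
    (S : NExangulated.NExangulatedStructure n E)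
    (hP : NExangulated.HasEnoughProjectives S.s) (hI : NExangulated.HasEnoughInjectives S.s)
    (X Y : C) :
    (∃ Φ : ((NExangulated.toStable S.s).obj X ⟶ (NExangulated.toStable S.s).obj Y) ≃+
        (E.obj (op Y) ⟶ E.obj (op X)),
      ∀ f : X ⟶ Y, Φ ((NExangulated.toStable S.s).map f) = E.map f.op) ∧
    (∃ Ψ : ((NExangulated.toCostable S.s).obj X ⟶ (NExangulated.toCostable S.s).obj Y) ≃+
        (E.flip.obj X ⟶ E.flip.obj Y),
      ∀ f : X ⟶ Y, Ψ ((NExangulated.toCostable S.s).map f) = E.flip.map f) := by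

  constructor
  · exact NExangulated.exists_addEquiv_idealQuotient (NExangulated.projectives S.s)
      (AddMonoidHom.mk' (fun f : X ⟶ Y => E.map f.op)
        fun f g => by rw [op_add, Functor.map_add])
      (NExangulated.exists_map_op_eq S hP) (NExangulated.map_op_eq_zero_iff S hP)
  · exact NExangulated.exists_addEquiv_idealQuotient (NExangulated.injectives S.s)
      (AddMonoidHom.mk' (fun f : X ⟶ Y => E.flip.map f)
        fun f g => by ext B δ; exact NExangulated.add_push (B := B.unop) f g δ)
      (NExangulated.exists_flip_map_eq S hI) (NExangulated.flip_map_eq_zero_iff S hI)
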